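/- **Theorem 1.1.** Let $k$ be an even integer and let $f$ be a weakly holomorphic modular form of weight $k$ and level $1$, that is, a holomorphic function on the upper half plane that transforms with weight $k$ under $\mathrm{SL}_2(\mathbb{Z})$ and is meromorphic at infinity. Let $f(z)=\sum_{n\gg-\infty}a_f(n)q^n$, $q=e^{2\pi i z}$, be its Fourier expansion, and suppose that all coefficients $a_f(n)$ lie in the ring of integers $O_L$ of a number field $L\subset\mathbb{C}$. Let $p$ be a prime and $t\ge 0$ an integer, and suppose that $\operatorname{ord}_\infty(f)>-p^t$, where $\operatorname{ord}_\infty(f)$ is the least $n$ with $a_f(n)\neq 0$ (and $+\infty$ if $f=0$). 1. If $p\ge 5$, $t>0$ and $2-k=r(p-1)+2p^t$ for some integer $r\ge 0$, then $a_f(p^t)\equiv 0\pmod p$, i.e. $a_f(p^t)\in pO_L$. 2. If $p\in\{2,3\}$ and $k+2p^t+m=2$ for some even integer $m\ge 4$, then $a_f(p^t)\equiv 0\pmod p$, i.e. $a_f(p^t)\in pO_L$. -/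

import Mathlib

open UpperHalfPlane
open scoped MatrixGroups Manifold ModularForm NumberField

noncomputable section

/-- A weakly holomorphic modular form of level `1` and weight `k`: a holomorphic function on the
upper half plane that is invariant under the weight `k` slash action of `SL(2, ℤ)` and, as a
function of `q = exp (2 * π * I * τ)`, is meromorphic at `q = 0` (so it may have a pole at the
cusp infinity). -/
structure WeaklyHolomorphicModularForm (k : ℤ) extends SlashInvariantForm 𝒮ℒ k where
  holo' : MDiff (toSlashInvariantForm : ℍ → ℂ)
  meromorphic_at_infty' : MeromorphicAt (UpperHalfPlane.cuspFunction 1 toFun) 0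

instance WeaklyHolomorphicModularForm.funLike (k : ℤ) :
    FunLike (WeaklyHolomorphicModularForm k) ℍ ℂ where
  coe f := f.toFun
  coe_injective f g h := by
    obtain ⟨⟨f, _⟩, _, _⟩ := f
    obtain ⟨⟨g, _⟩, _, _⟩ := g
    congr

/-- `a` is the Fourier expansion of `f` at infinity: for every `τ` in the upper half plane,
`f τ = ∑ n, a n * q ^ n` where `q = exp (2 * π * I * τ)`, the sum running over all integers `n`.
That `a n = 0` for all sufficiently negative `n` is part of `a` being a Laurent series. -/
def HasFourierExpansion (f : ℍ → ℂ) (a : LaurentSeries ℂ) : Prop :=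
  ∀ τ : ℍ, HasSum (fun n : ℤ => a.coeff n * Function.Periodic.qParam 1 (τ : ℂ) ^ n) (f τ)

/-- The order at infinity of a form with Fourier expansion `a`: the least `n` with `a n ≠ 0`,
and `⊤` if `a = 0`. -/
def ordInfty {R : Type*} [Zero R] (a : LaurentSeries R) : WithTop ℤ :=
  HahnSeries.orderTop a

end

/-!
Let `P = p ^ t`. The product of `f` with a weakly holomorphic form `g` of weight `2 - k` has weight
two, hence no constant term: the sum over `n` of `a_f(n) a_g(-n)` vanishes. The congruence is
this relation for `g = F * (q dj/dq) ^ P`, where `F` is a holomorphic form of level one with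
integral coefficients that is congruent, modulo `p`, to a constant prime to `p`. Indeed `q dj/dq`,
a weight two form with integral coefficients, is `-q⁻¹ + O(q)`: as a derivative it has no constant
term. Modulo `p` its `P`-th power is therefore, up to sign, `q ^ (-P) * (1 + O(q ^ (2 * P)))`, and
as `f` has a pole of order less than `P`, all that is left of the relation is `a_f(P) ≡ 0`.

* The form `F` has weight `r (p - 1)` for `p ≥ 5`, as the `r`-th power of a multiple of `E_{p-1}`;
  this rests on the theorem of von Staudt and Clausen. For `p = 2, 3` it is a monomial in `E₄` and
  `E₆`, which are congruent to `1` modulo `24`. See `HasFormCongruentToUnit`.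
* Everything is written in terms of holomorphic forms and their `q`-expansions, by multiplying with
  powers of `Δ = q U`; the role of `-q dj/dq` is played by `E₄ ^ 2 * E₆ / Δ`, and integrality of
  `U` is proved in `exists_map_eq_discriminant` from `1728 Δ = E₄ ^ 3 - E₆ ^ 2`.
* That weight two forms have no constant term is `coeff_mul_pow_eq_zero_of_weight`. Subtracting
  multiples of `j ^ M * (q dj/dq)`, a derivative up to a scalar, lowers the order of the pole until
  a holomorphic form of weight two is left, which vanishes. The formula for the derivative of `j`
  is the evaluation of a Rankin–Cohen bracket, `rankinCohen_E₄_discriminant`.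
-/

open scoped PowerSeries

/-- The `q`-expansion of `E₄`. -/
local notation "E₄q" => qExpansion 1 (ModularForm.E₄ : ℍ → ℂ)

/-- The `q`-expansion of `E₆`. -/
local notation "E₆q" => qExpansion 1 (ModularForm.E₆ : ℍ → ℂ)

/-- The `q`-expansion of the discriminant. -/
local notation "Δq" => qExpansion 1 ModularForm.discriminant

/-! ### The `q`-expansions of level one forms of a given weight -/

/-- `A` is the `q`-expansion of a holomorphic modular form of level one and weight `k`. Speaking of
the `q`-expansions only makes it possible to change weights along equalities without casts. -/
def IsQExpansionOfWeight (k : ℤ) (A : ℂ⟦X⟧) : Prop :=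
  ∃ g : ModularForm 𝒮ℒ k, qExpansion 1 g = A

namespace IsQExpansionOfWeight

variable {k l : ℤ} {A B : ℂ⟦X⟧}

lemma congr_weight (h : IsQExpansionOfWeight k A) (hkl : k = l) : IsQExpansionOfWeight l A :=
  hkl ▸ h

lemma mul (hA : IsQExpansionOfWeight k A) (hB : IsQExpansionOfWeight l B) :
    IsQExpansionOfWeight (k + l) (A * B) := by
  obtain ⟨f, rfl⟩ := hA
  obtain ⟨g, rfl⟩ := hB
  exact ⟨f.mul g, ModularForm.qExpansion_mul one_pos one_mem_strictPeriods_SL f g⟩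

lemma pow (hA : IsQExpansionOfWeight k A) (n : ℕ) : IsQExpansionOfWeight (n * k) (A ^ n) := by
  obtain ⟨f, rfl⟩ := hA
  exact ⟨f.pow n, ModularForm.qExpansion_pow one_pos one_mem_strictPeriods_SL f n⟩

lemma sub (hA : IsQExpansionOfWeight k A) (hB : IsQExpansionOfWeight k B) :
    IsQExpansionOfWeight k (A - B) := by
  obtain ⟨f, rfl⟩ := hA
  obtain ⟨g, rfl⟩ := hB
  exact ⟨f - g, ModularForm.qExpansion_sub one_pos one_mem_strictPeriods_SL f g⟩

lemma smul (hA : IsQExpansionOfWeight k A) (c : ℂ) : IsQExpansionOfWeight k (c • A) := by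
  obtain ⟨f, rfl⟩ := hA
  exact ⟨c • f, ModularForm.qExpansion_smul one_pos one_mem_strictPeriods_SL c f⟩

lemma eq_zero_of_weight_two (hA : IsQExpansionOfWeight 2 A) : A = 0 := by
  obtain ⟨f, rfl⟩ := hA
  rw [rank_zero_iff_forall_zero.mp ModularForm.levelOne_weight_two_rank_zero f]
  exact qExpansion_zero 1

lemma exists_smul_of_weight_six (hA : IsQExpansionOfWeight 6 A) :
    ∃ c : ℂ, A = c • qExpansion 1 ModularForm.E₆ := by
  obtain ⟨f, rfl⟩ := hA
  obtain ⟨c, rfl⟩ := (finrank_eq_one_iff_of_nonzero' ModularForm.E₆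
    (EisensteinSeries.E_ne_zero _ ⟨3, rfl⟩)).mp
      (Module.rank_eq_one_iff_finrank_eq_one.mp ModularForm.levelOne_weight_six_rank_one) f
  exact ⟨c, ModularForm.qExpansion_smul one_pos one_mem_strictPeriods_SL c ModularForm.E₆⟩

/-- A level one form with vanishing constant term is `Δ` times a form of weight `k - 12`. -/
lemma exists_eq_discriminant_mul (hA : IsQExpansionOfWeight k A) (h0 : A.coeff 0 = 0) :
    ∃ B, IsQExpansionOfWeight (k - 12) B ∧ A = qExpansion 1 ModularForm.discriminant * B := by
  obtain ⟨f, rfl⟩ := hA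
  exact ⟨_, ⟨_, rfl⟩, ModularForm.qExpansion_eq_qExpansion_discriminant_mul f h0⟩

end IsQExpansionOfWeight

/-! ### Convergent `q`-series -/

/-- The function `f` on the upper half plane is given everywhere by the convergent `q`-series with
coefficients `A`. No modularity is asked for. -/
def HasQSeries (f : ℍ → ℂ) (A : PowerSeries ℂ) : Prop :=
  ∀ τ : ℍ, HasSum (fun n : ℕ ↦ A.coeff n * Function.Periodic.qParam 1 (τ : ℂ) ^ n) (f τ)

namespace HasQSeries

variable {f g : ℍ → ℂ} {A B : ℂ⟦X⟧}

lemma mul (hf : HasQSeries f A) (hg : HasQSeries g B) : HasQSeries (f * g) (A * B) := by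
  intro τ
  have ha := (hf τ).summable.norm
  have hb := (hg τ).summable.norm
  have h := (summable_norm_sum_mul_antidiagonal_of_summable_norm ha hb).of_norm.hasSum
  rw [← tsum_mul_tsum_eq_tsum_sum_antidiagonal_of_summable_norm ha hb, (hf τ).tsum_eq,
    (hg τ).tsum_eq] at h
  refine h.congr_fun fun n ↦ ?_
  rw [PowerSeries.coeff_mul, Finset.sum_mul]
  refine Finset.sum_congr rfl fun x hx ↦ ?_
  rw [← Finset.HasAntidiagonal.mem_antidiagonal.mp hx, pow_add]
  ring

lemma one : HasQSeries 1 1 := by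
  intro τ
  convert hasSum_single (f := fun n : ℕ ↦
    (1 : ℂ⟦X⟧).coeff n * Function.Periodic.qParam 1 (τ : ℂ) ^ n) 0 ?_ using 1
  · simp
  · intro n hn
    simp [PowerSeries.coeff_one, hn]

lemma pow (hf : HasQSeries f A) (n : ℕ) : HasQSeries (f ^ n) (A ^ n) := by
  induction n with
  | zero => simpa using one
  | succ n ih => simpa only [pow_succ] using ih.mul hf

lemma sub (hf : HasQSeries f A) (hg : HasQSeries g B) : HasQSeries (f - g) (A - B) := by
  intro τ
  simpa [sub_mul] using (hf τ).sub (hg τ)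

lemma smul (hf : HasQSeries f A) (c : ℂ) : HasQSeries (c • f) (c • A) := by
  intro τ
  simpa [mul_assoc] using (hf τ).mul_left c

lemma isBoundedAtImInfty (hf : HasQSeries f A) : IsBoundedAtImInfty f :=
  isBoundedAtImInfty_of_hasSum_qExpansion one_pos hf

/-- A function whose `q`-series has no constant term may be divided by `q`. -/
lemma div_qParam (hf : HasQSeries f (PowerSeries.X * A)) :
    HasQSeries (fun τ ↦ f τ / Function.Periodic.qParam 1 (τ : ℂ)) A := by
  intro τ
  have hq : Function.Periodic.qParam 1 (τ : ℂ) ≠ 0 := Function.Periodic.qParam_ne_zero _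
  have h := hf τ
  rw [← hasSum_nat_add_iff' 1] at h
  simp only [PowerSeries.coeff_succ_X_mul, Finset.range_one, Finset.sum_singleton,
    PowerSeries.coeff_zero_X_mul, zero_mul, sub_zero] at h
  refine (h.div_const _).congr_fun fun n ↦ ?_
  rw [pow_succ, ← mul_assoc, mul_div_cancel_right₀ _ hq]

end HasQSeries

lemma ModularFormClass.hasQSeries {F : Type*} [FunLike F ℍ ℂ] {k : ℤ} [ModularFormClass F 𝒮ℒ k]
    (f : F) : HasQSeries f (qExpansion 1 f) :=
  ModularForm.hasSum_qExpansion f one_pos one_mem_strictPeriods_SL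

/-- A holomorphic function that is invariant in weight `k` and has a `q`-series is a modular
form: the `q`-series bounds it at infinity, and level one has only this cusp. -/
lemma HasQSeries.isQExpansionOfWeight {f : ℍ → ℂ} {A : PowerSeries ℂ} {k : ℤ}
    (hf : HasQSeries f A) (hol : MDiff f)
    (hslash : ∀ γ : SL(2, ℤ), f ∣[k] γ = f) : IsQExpansionOfWeight k A := by
  let g : ModularForm 𝒮ℒ k :=
    { toFun := f
      slash_action_eq' := fun _ ⟨γ, hγ⟩ ↦ hγ ▸ hslash γ
      holo' := hol
      bdd_at_cusps' := fun {c} hc ↦ by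
        rw [Subgroup.IsArithmetic.isCusp_iff_isCusp_SL2Z] at hc
        rw [OnePoint.isBoundedAt_iff_forall_SL2Z hc]
        intro γ _
        rw [hslash γ]
        exact hf.isBoundedAtImInfty }
  refine ⟨g, ?_⟩
  ext n
  exact (ModularFormClass.qExpansion_coeff_unique (F := ModularForm 𝒮ℒ k) (k := k)
    (Γ := 𝒮ℒ) (f := g) (c := fun n ↦ A.coeff n) one_pos one_mem_strictPeriods_SL hf n).symm

open scoped Derivative in
/-- The derivative `(2πi)⁻¹ d/dτ` acts on `q`-series as `q d/dq`. -/
lemma ModularFormClass.hasQSeries_normalizedDeriv {F : Type*} [FunLike F ℍ ℂ] {k : ℤ}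
    [ModularFormClass F 𝒮ℒ k] (f : F) :
    HasQSeries (Derivative.normalizedDerivOfComplex f)
      (PowerSeries.X * PowerSeries.derivative ℂ (qExpansion 1 f)) := by
  intro τ
  set q := Function.Periodic.qParam 1 (τ : ℂ) with hq
  have hq1 : ‖q‖ < 1 := Function.Periodic.norm_qParam_lt_one one_pos τ.im_pos
  set φ := cuspFunction 1 f with hφ
  have hφd : DifferentiableOn ℂ φ (Metric.ball 0 1) := fun z hz ↦
    (ModularFormClass.differentiableAt_cuspFunction f one_pos one_mem_strictPeriods_SL
      (by simpa using hz)).differentiableWithinAt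
  have hD : Derivative.normalizedDerivOfComplex f τ = q * deriv φ q := by
    have h1 : HasDerivAt (Function.Periodic.qParam 1) (q * (2 * Real.pi * Complex.I)) (τ : ℂ) := by
      have := ((hasDerivAt_id (τ : ℂ)).const_mul (2 * Real.pi * Complex.I)).cexp
      have hqP : Function.Periodic.qParam 1 =
          fun z : ℂ ↦ Complex.exp (2 * Real.pi * Complex.I * z) := by
        ext z
        simp [Function.Periodic.qParam]
      rw [hq, hqP]
      simpa using this
    have h2 : HasDerivAt φ (deriv φ q) (Function.Periodic.qParam 1 (τ : ℂ)) :=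
      (ModularFormClass.differentiableAt_cuspFunction f one_pos one_mem_strictPeriods_SL
        hq1).hasDerivAt
    have h3 : (f ∘ ofComplex : ℂ → ℂ) =ᶠ[nhds (τ : ℂ)] φ ∘ Function.Periodic.qParam 1 := by
      filter_upwards [isOpen_upperHalfPlaneSet.mem_nhds τ.im_pos] with w hw
      rw [Function.comp_apply, Function.comp_apply, ofComplex_apply_of_im_pos hw]
      exact (SlashInvariantFormClass.eq_cuspFunction f ⟨w, hw⟩ one_mem_strictPeriods_SL
        one_ne_zero).symm
    rw [Derivative.normalizedDerivOfComplex, ((h2.comp _ h1).congr_of_eventuallyEq h3).deriv]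
    field_simp [Complex.two_pi_I_ne_zero]
  have hT := Complex.hasSum_taylorSeries_on_ball (c := 0) (r := 1)
    (hφd.deriv Metric.isOpen_ball) (z := q) (by simpa using hq1)
  rw [hD, ← hasSum_nat_add_iff' 1]
  simp only [PowerSeries.coeff_succ_X_mul, Finset.range_one, Finset.sum_singleton,
    PowerSeries.coeff_zero_X_mul, zero_mul, sub_zero]
  refine (hT.mul_left q).congr_fun fun n ↦ ?_
  rw [PowerSeries.coeff_derivative, qExpansion_coeff, ← iteratedDeriv_succ', Nat.factorial_succ]
  push_cast
  have : (n + 1 : ℂ) ≠ 0 := Nat.cast_add_one_ne_zero n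
  simp only [smul_eq_mul, sub_zero, hφ]
  field_simp
  ring

/-! ### Weight two forms have no constant term -/

lemma isQExpansionOfWeight_E₄ : IsQExpansionOfWeight 4 E₄q := ⟨_, rfl⟩

lemma isQExpansionOfWeight_E₆ : IsQExpansionOfWeight 6 E₆q := ⟨_, rfl⟩

lemma constantCoeff_E₄ : PowerSeries.constantCoeff E₄q = 1 := by
  simpa using EisensteinSeries.E_qExpansion_coeff_zero (k := 4) (by norm_num) ⟨2, rfl⟩

lemma constantCoeff_E₆ : PowerSeries.constantCoeff E₆q = 1 := by
  simpa using EisensteinSeries.E_qExpansion_coeff_zero (k := 6) (by norm_num) ⟨3, rfl⟩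

lemma constantCoeff_discriminant : PowerSeries.constantCoeff Δq = 0 := by
  simpa using CuspFormClass.qExpansion_coeff_zero CuspForm.discriminant one_pos
    one_mem_strictPeriods_SL

/-- The Rankin–Cohen bracket of `E₄` and `Δ` is `-Δ E₆`. It is a cusp form of weight `18`, because
the contributions of `E₂` to the Serre derivatives of `E₄` and `Δ` cancel, and the space of such
forms is one-dimensional. -/
lemma rankinCohen_E₄_discriminant :
    3 * (Δq * (PowerSeries.X * PowerSeries.derivative ℂ E₄q)) -
      E₄q * (PowerSeries.X * PowerSeries.derivative ℂ Δq) = -(Δq * E₆q) := by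
  set E : ℍ → ℂ := ⇑ModularForm.E₄
  set Δ : ℍ → ℂ := ModularForm.discriminant
  have hE : MDiff E := ModularForm.E₄.holo'
  have hΔ : MDiff Δ := CuspForm.discriminant.holo'
  have hEs (γ : SL(2, ℤ)) : E ∣[(4 : ℤ)] γ = E := ModularForm.E₄.slash_action_eq' _ ⟨γ, rfl⟩
  have hΔs (γ : SL(2, ℤ)) : Δ ∣[(12 : ℤ)] γ = Δ :=
    CuspForm.discriminant.slash_action_eq' _ ⟨γ, rfl⟩
  have hEQ : HasQSeries E (qExpansion 1 E) := ModularFormClass.hasQSeries ModularForm.E₄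
  have hΔQ : HasQSeries Δ (qExpansion 1 Δ) := ModularFormClass.hasQSeries CuspForm.discriminant
  have hDE : HasQSeries (Derivative.normalizedDerivOfComplex E)
      (PowerSeries.X * PowerSeries.derivative ℂ (qExpansion 1 E)) :=
    ModularFormClass.hasQSeries_normalizedDeriv ModularForm.E₄
  have hDΔ : HasQSeries (Derivative.normalizedDerivOfComplex Δ)
      (PowerSeries.X * PowerSeries.derivative ℂ (qExpansion 1 Δ)) :=
    ModularFormClass.hasQSeries_normalizedDeriv CuspForm.discriminant
  have hR : HasQSeries ((3 : ℂ) • (Δ * Derivative.normalizedDerivOfComplex E) -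
      E * Derivative.normalizedDerivOfComplex Δ) _ := ((hΔQ.mul hDE).smul 3).sub (hEQ.mul hDΔ)
  have hSerre : (3 : ℂ) • (Δ * Derivative.normalizedDerivOfComplex E) -
      E * Derivative.normalizedDerivOfComplex Δ =
      (3 : ℂ) • (Δ * Derivative.serreDerivative (4 : ℤ) E) -
        E * Derivative.serreDerivative (12 : ℤ) Δ := by
    ext τ
    simp only [Pi.sub_apply, Pi.smul_apply, Pi.mul_apply, Derivative.serreDerivative_apply,
      smul_eq_mul]
    push_cast
    ring
  have hW : IsQExpansionOfWeight 18 _ := hR.isQExpansionOfWeight (k := 18)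
    (by
      rw [hSerre]
      exact ((hΔ.mul (Derivative.serreDerivative_mdifferentiable _ hE)).const_smul _).sub
        (hE.mul (Derivative.serreDerivative_mdifferentiable _ hΔ)))
    (by
      intro γ
      have h1 : (Δ * Derivative.serreDerivative (4 : ℤ) E) ∣[(18 : ℤ)] γ =
          Δ * Derivative.serreDerivative (4 : ℤ) E := by
        rw [show (18 : ℤ) = 12 + (4 + 2) by norm_num, ModularForm.mul_slash_SL2,
          Derivative.serreDerivative_slash_invariant hE (hEs γ), hΔs]
      have h2 : (E * Derivative.serreDerivative (12 : ℤ) Δ) ∣[(18 : ℤ)] γ =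
          E * Derivative.serreDerivative (12 : ℤ) Δ := by
        rw [show (18 : ℤ) = 4 + (12 + 2) by norm_num, ModularForm.mul_slash_SL2,
          Derivative.serreDerivative_slash_invariant hΔ (hΔs γ), hEs]
      rw [hSerre, sub_eq_add_neg, SlashAction.add_slash, SlashAction.neg_slash,
        ModularForm.SL_smul_slash, h1, h2])
  have hΔ0 : PowerSeries.constantCoeff (qExpansion 1 Δ) = 0 := constantCoeff_discriminant
  obtain ⟨B, hB, hWB⟩ := hW.exists_eq_discriminant_mul (by simp [hΔ0])
  change _ = qExpansion 1 Δ * B at hWB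
  obtain ⟨c, rfl⟩ := (hB.congr_weight (l := 6) (by norm_num)).exists_smul_of_weight_six
  -- The coefficients of `q` determine the scalar.
  have hc : c = -1 := by
    have h := congrArg (PowerSeries.coeff 1) hWB
    have hE0 : PowerSeries.constantCoeff (qExpansion 1 E) = 1 := constantCoeff_E₄
    have hΔ1 : PowerSeries.coeff 1 (qExpansion 1 Δ) = 1 :=
      ModularForm.discriminant_qExpansion_coeff_one
    simp [PowerSeries.coeff_mul, Finset.Nat.antidiagonal_succ, hΔ0, hE0, hΔ1,
      PowerSeries.coeff_X, constantCoeff_E₆, PowerSeries.coeff_derivative] at h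
    exact h.symm
  have h3 : ((3 : ℂ) • (qExpansion 1 Δ * (PowerSeries.X * PowerSeries.derivative ℂ
      (qExpansion 1 E))) : ℂ⟦X⟧) = 3 * (qExpansion 1 Δ * (PowerSeries.X *
        PowerSeries.derivative ℂ (qExpansion 1 E))) := by
    rw [PowerSeries.smul_eq_C_mul, map_ofNat]
  rw [← h3]
  refine hWB.trans ?_
  rw [hc]
  simp

/-- A purely formal fact: for `j = V / q`, the form `j ^ M * (q d/dq) j` is the derivative of
`j ^ (M + 1) / (M + 1)`, and so it has no constant term. -/
lemma PowerSeries.coeff_pow_mul_derivative_sub {K : Type*} [Field K] [CharZero K] (V : K⟦X⟧)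
    (M : ℕ) : (V ^ M * (X * derivative K V - V)).coeff (M + 1) = 0 := by
  have h : ((M + 1 : ℕ) : K⟦X⟧) * (V ^ M * (X * derivative K V - V)) =
      X * derivative K (V ^ (M + 1)) - ((M + 1 : ℕ) : K⟦X⟧) * V ^ (M + 1) := by
    rw [derivative_pow]
    simp only [Nat.add_sub_cancel]
    ring
  have h' := congrArg (coeff (M + 1)) h
  simp only [← nsmul_eq_mul, map_nsmul, map_sub, coeff_succ_X_mul, coeff_derivative] at h'
  rw [nsmul_eq_mul, nsmul_eq_mul] at h'
  have h0 : ((M + 1 : ℕ) : K) ≠ 0 := Nat.cast_ne_zero.mpr M.succ_ne_zero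
  refine (mul_eq_zero.mp (h'.trans ?_)).resolve_left h0
  push_cast
  ring

/-- Since `Y = q / Δ`, the coefficient in question is the constant term of the weakly holomorphic
form `A / Δ ^ M` of weight two, that is, its residue at the only cusp of level one. In the
induction on `M`, forms that do not vanish at infinity are reduced to cusp forms by multiples of
`E₄ ^ (3 * M + 2) * E₆`; divided by `Δ ^ (M + 1)`, this is `-j ^ M` times the derivative of
`j = E₄ ^ 3 / Δ`. -/
theorem coeff_mul_pow_eq_zero_of_weight {U Y : ℂ⟦X⟧} (hU : Δq = PowerSeries.X * U)
    (hUY : U * Y = 1) (M : ℕ) {A : ℂ⟦X⟧} (hA : IsQExpansionOfWeight (12 * M + 2) A) :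
    (A * Y ^ M).coeff M = 0 := by
  -- The derivative of `j`, from the Rankin–Cohen bracket of `E₄` and `Δ`.
  have hj : PowerSeries.X * PowerSeries.derivative ℂ (E₄q ^ 3 * Y) - E₄q ^ 3 * Y =
      -(E₄q ^ 2 * E₆q * Y) := by
    have hdU : U * PowerSeries.derivative ℂ Y + Y * PowerSeries.derivative ℂ U = 0 := by
      simpa [Derivation.leibniz] using congrArg (PowerSeries.derivative ℂ) hUY
    have hR := rankinCohen_E₄_discriminant
    rw [hU] at hR
    simp only [Derivation.leibniz, smul_eq_mul, PowerSeries.derivative_X, mul_one] at hR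
    have hR' : 3 * (U * (PowerSeries.X * PowerSeries.derivative ℂ E₄q)) -
        E₄q * (PowerSeries.X * PowerSeries.derivative ℂ U + U) = -(U * E₆q) :=
      mul_left_cancel₀ (PowerSeries.X_ne_zero (R := ℂ)) (by linear_combination hR)
    simp only [Derivation.leibniz, smul_eq_mul, PowerSeries.derivative_pow]
    push_cast
    linear_combination (E₄q ^ 2 * Y ^ 2) * hR' + (PowerSeries.X * E₄q ^ 3 * Y) * hdU
     - (E₄q ^ 3 * PowerSeries.X * PowerSeries.derivative ℂ Y +
       3 * E₄q ^ 2 * Y * PowerSeries.X * PowerSeries.derivative ℂ E₄q - E₄q ^ 3 * Y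
         + E₄q ^ 2 * E₆q * Y) * hUY
  induction M generalizing A with
  | zero => simp [(hA.congr_weight (l := 2) (by simp)).eq_zero_of_weight_two]
  | succ M ih =>
    have hB : IsQExpansionOfWeight (12 * (M + 1 : ℕ) + 2) (E₄q ^ (3 * M + 2) * E₆q) :=
      ((isQExpansionOfWeight_E₄.pow _).mul isQExpansionOfWeight_E₆).congr_weight
        (by push_cast; ring)
    have hBY : (E₄q ^ (3 * M + 2) * E₆q * Y ^ (M + 1)).coeff (M + 1) = 0 := by
      have h := PowerSeries.coeff_pow_mul_derivative_sub (E₄q ^ 3 * Y) M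
      rw [hj, mul_neg, map_neg, neg_eq_zero] at h
      rw [← h]
      congr 1
      ring
    obtain ⟨c, hc⟩ : ∃ c, c = A.coeff 0 := ⟨_, rfl⟩
    obtain ⟨G, hG, hAG⟩ := (hA.sub (hB.smul c)).exists_eq_discriminant_mul
      (by simp [hc, constantCoeff_E₄, constantCoeff_E₆])
    have hGM := ih (hG.congr_weight (by push_cast; ring))
    have hdec : A * Y ^ (M + 1) = c • (E₄q ^ (3 * M + 2) * E₆q * Y ^ (M + 1)) +
        PowerSeries.X * (G * Y ^ M) := by
      rw [sub_eq_iff_eq_add.mp hAG, hU, PowerSeries.smul_eq_C_mul, PowerSeries.smul_eq_C_mul]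
      linear_combination (PowerSeries.X * G * Y ^ M) * hUY
    rw [hdec, map_add, PowerSeries.coeff_smul, hBY, PowerSeries.coeff_succ_X_mul, hGM]
    simp

/-! ### Integrality of the discriminant -/

/-- The power series `∑ σ_k(n) X ^ n`, the sum running over `n ≥ 1` since `σ_k(0) = 0`. -/
noncomputable def sigmaSeries (k : ℕ) : ℤ⟦X⟧ :=
  PowerSeries.mk fun n ↦ (ArithmeticFunction.sigma k n : ℤ)

lemma coeff_sigmaSeries (k n : ℕ) :
    (sigmaSeries k).coeff n = (ArithmeticFunction.sigma k n : ℤ) := by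
  simp [sigmaSeries]

/-- An integral multiple `c` of the Eisenstein series `E_k` that clears the denominator of
`2 k / B_k` has integral coefficients. -/
lemma map_one_add_sigmaSeries {k : ℕ} (hk : 3 ≤ k) (hk2 : Even k) (c d : ℤ)
    (h : c * (-(2 * k / bernoulli k : ℂ)) = d) :
    PowerSeries.map (Int.castRingHom ℂ) (PowerSeries.C c + PowerSeries.C d * sigmaSeries (k - 1)) =
      (c : ℂ) • qExpansion 1 (ModularForm.E hk) := by
  ext n
  simp only [map_add, map_mul, PowerSeries.map_C, PowerSeries.coeff_C_mul, PowerSeries.coeff_map,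
    PowerSeries.coeff_C, PowerSeries.coeff_smul, EisensteinSeries.E_qExpansion_coeff hk hk2,
    coeff_sigmaSeries, smul_eq_mul]
  rcases eq_or_ne n 0 with rfl | hn
  · simp
  · simp [hn, ← h]
    ring

lemma map_E₄ : PowerSeries.map (Int.castRingHom ℂ) (1 + 240 * sigmaSeries 3) = E₄q := by
  have h := map_one_add_sigmaSeries (k := 4) (by norm_num) ⟨2, rfl⟩ 1 240
    (by norm_num [show bernoulli 4 = -1 / 30 by decide +kernel])
  simpa using h

lemma map_E₆ : PowerSeries.map (Int.castRingHom ℂ) (1 - 504 * sigmaSeries 5) = E₆q := by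
  have h := map_one_add_sigmaSeries (k := 6) (by norm_num) ⟨3, rfl⟩ 1 (-504)
    (by norm_num [show bernoulli 6 = 1 / 42 by decide +kernel])
  simpa [sub_eq_add_neg] using h

/-- Summand by summand over the divisors of `n`: `5 d ^ 3 + 7 d ^ 5` is divisible by `12`. -/
lemma twelve_dvd_sigma (n : ℕ) :
    (12 : ℤ) ∣ 5 * (ArithmeticFunction.sigma 3 n : ℤ) + 7 * (ArithmeticFunction.sigma 5 n : ℤ) := by
  simp only [ArithmeticFunction.sigma_apply]
  push_cast
  rw [Finset.mul_sum, Finset.mul_sum, ← Finset.sum_add_distrib]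
  refine Finset.dvd_sum fun d _ ↦ ?_
  have h : ∀ x : ZMod 12, 5 * x ^ 3 + 7 * x ^ 5 = 0 := by decide
  refine (ZMod.intCast_zmod_eq_zero_iff_dvd _ 12).mp ?_
  push_cast
  exact h d

/-- The `q`-expansion of `Δ` is integral. The congruence between `σ₃` and `σ₅` is what is needed to
divide `E₄ ^ 3 - E₆ ^ 2` by `1728`. -/
lemma exists_map_eq_discriminant : ∃ D : ℤ⟦X⟧, PowerSeries.map (Int.castRingHom ℂ) D = Δq ∧
    D.coeff 0 = 0 ∧ D.coeff 1 = 1 ∧ D.coeff 2 = -24 := by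
  choose c hc using twelve_dvd_sigma
  set S := sigmaSeries 3
  set T := sigmaSeries 5
  have hC : 5 * S + 7 * T = 12 * PowerSeries.mk c := by
    ext n
    have h5 : (5 : ℤ⟦X⟧) = PowerSeries.C 5 := (map_ofNat PowerSeries.C 5).symm
    have h7 : (7 : ℤ⟦X⟧) = PowerSeries.C 7 := (map_ofNat PowerSeries.C 7).symm
    have h12 : (12 : ℤ⟦X⟧) = PowerSeries.C 12 := (map_ofNat PowerSeries.C 12).symm
    rw [h5, h7, h12]
    simp only [map_add, PowerSeries.coeff_C_mul, PowerSeries.coeff_mk, S, T, coeff_sigmaSeries, hc]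
  have hΔ : (1728 : ℂ) • Δq = E₄q ^ 3 - E₆q ^ 2 := by
    have h1 := ModularFormClass.hasQSeries CuspForm.discriminant
    have h2 := ((ModularFormClass.hasQSeries ModularForm.E₄).pow 3).sub
      ((ModularFormClass.hasQSeries ModularForm.E₆).pow 2)
    have h3 : ((ModularForm.E₄ : ℍ → ℂ) ^ 3 - (ModularForm.E₆ : ℍ → ℂ) ^ 2) =
        ⇑((1728 : ℂ) • CuspForm.discriminant) := by
      ext τ
      change _ = 1728 * ModularForm.discriminant τ
      rw [ModularForm.discriminant_eq_E₄_cube_sub_E₆_sq]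
      simp only [Pi.sub_apply, Pi.pow_apply]
      ring
    rw [h3] at h2
    have h4 := ModularForm.qExpansion_smul one_pos one_mem_strictPeriods_SL (1728 : ℂ)
      CuspForm.discriminant
    rw [CuspForm.coe_discriminant] at h4
    rw [← h4]
    ext n
    exact (ModularFormClass.qExpansion_coeff_unique one_pos one_mem_strictPeriods_SL h2 n).symm
  refine ⟨PowerSeries.mk c + 100 * S ^ 2 + 8000 * S ^ 3 - 147 * T ^ 2, ?_, ?_⟩
  · have h1728 : (1728 : ℂ⟦X⟧) ≠ 0 := by
      rw [← map_ofNat PowerSeries.C]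
      simp
    refine mul_left_cancel₀ h1728 ?_
    have hΔ' : (1728 : ℂ⟦X⟧) * Δq = E₄q ^ 3 - E₆q ^ 2 := by
      rw [← hΔ, PowerSeries.smul_eq_C_mul, map_ofNat]
    rw [hΔ', ← map_E₄, ← map_E₆, ← map_ofNat (PowerSeries.map (Int.castRingHom ℂ)) 1728,
      ← map_mul, ← map_pow, ← map_pow, ← map_sub]
    congr 1
    linear_combination (-144) * hC
  · have hc0 := hc 0
    have hc1 := hc 1
    have hc2 := hc 2
    have s32 : ArithmeticFunction.sigma 3 2 = 9 := by decide +kernel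
    have s52 : ArithmeticFunction.sigma 5 2 = 33 := by decide +kernel
    rw [s32, s52] at hc2
    simp at hc0 hc1
    have h100 : (100 : ℤ⟦X⟧) = PowerSeries.C 100 := (map_ofNat PowerSeries.C 100).symm
    have h8000 : (8000 : ℤ⟦X⟧) = PowerSeries.C 8000 := (map_ofNat PowerSeries.C 8000).symm
    have h147 : (147 : ℤ⟦X⟧) = PowerSeries.C 147 := (map_ofNat PowerSeries.C 147).symm
    rw [h100, h8000, h147]
    simp only [map_add, map_sub, PowerSeries.coeff_C_mul, PowerSeries.coeff_mk]
    simp [pow_succ, PowerSeries.coeff_mul, Finset.Nat.antidiagonal_succ, S, T, coeff_sigmaSeries]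
    omega

/-- Here `U = Δ / q`, `Y = q / Δ`, and the last series is `-q` times the derivative
`q dj/dq = -q⁻¹ + O(q)` of the `j`-invariant. That it has no term of degree one reflects that a
derivative has no constant term, but is simply read off from the first coefficients. -/
lemma exists_integral_unit_discriminant : ∃ U Y T : ℤ⟦X⟧,
    Δq = PowerSeries.X * PowerSeries.map (Int.castRingHom ℂ) U ∧ U * Y = 1 ∧
    E₄q ^ 2 * E₆q * PowerSeries.map (Int.castRingHom ℂ) Y =
      PowerSeries.map (Int.castRingHom ℂ) (1 + PowerSeries.X ^ 2 * T) := by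
  obtain ⟨D, hD, h0, h1, h2⟩ := exists_map_eq_discriminant
  obtain ⟨U, rfl⟩ := PowerSeries.X_dvd_iff.mpr (by simpa using h0)
  rw [PowerSeries.coeff_succ_X_mul] at h1 h2
  have hUY := PowerSeries.mul_invOfUnit U 1 (by simpa using h1)
  set Y := PowerSeries.invOfUnit U 1
  have hY0 : PowerSeries.constantCoeff Y = 1 := by simp [Y]
  have hY1 : Y.coeff 1 = 24 := by
    have h := congrArg (PowerSeries.coeff 1) hUY
    simp only [PowerSeries.coeff_mul, Finset.Nat.antidiagonal_succ, PowerSeries.coeff_one] at h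
    simp at h h1
    rw [h1, h2, hY0] at h
    omega
  have hdvd : (PowerSeries.X : ℤ⟦X⟧) ^ 2 ∣
      (1 + 240 * sigmaSeries 3) ^ 2 * (1 - 504 * sigmaSeries 5) * Y - 1 := by
    rw [PowerSeries.X_pow_dvd_iff]
    have h240 : PowerSeries.constantCoeff (240 : ℤ⟦X⟧) = 240 := map_ofNat _ 240
    have h504 : PowerSeries.constantCoeff (504 : ℤ⟦X⟧) = 504 := map_ofNat _ 504
    have h240' : PowerSeries.coeff 1 (240 : ℤ⟦X⟧) = 0 := by
      rw [← map_ofNat PowerSeries.C, PowerSeries.coeff_C, if_neg one_ne_zero]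
    have h504' : PowerSeries.coeff 1 (504 : ℤ⟦X⟧) = 0 := by
      rw [← map_ofNat PowerSeries.C, PowerSeries.coeff_C, if_neg one_ne_zero]
    have s0 (k : ℕ) : PowerSeries.constantCoeff (sigmaSeries k) = 0 := by
      simpa using coeff_sigmaSeries k 0
    have s1 (k : ℕ) : (sigmaSeries k).coeff 1 = 1 := by simp [coeff_sigmaSeries]
    intro m hm
    interval_cases m
    · simp [s0, hY0]
    · simp [s0, s1, hY0, hY1, pow_two, PowerSeries.coeff_mul, Finset.Nat.antidiagonal_succ,
        PowerSeries.coeff_one, h240, h504, h240', h504']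
  obtain ⟨T, hT⟩ := hdvd
  refine ⟨U, Y, T, ?_, hUY, ?_⟩
  · rw [← hD, map_mul, PowerSeries.map_X]
  · rw [← hT, ← map_E₄, ← map_E₆]
    simp only [← map_mul, ← map_pow]
    congr 1
    ring

/-! ### Forms congruent to a constant -/

/-- Part of the theorem of von Staudt and Clausen: `p` divides the denominator of `B_{p-1}`. -/
lemma dvd_den_bernoulli {p : ℕ} (hp : p.Prime) (hodd : Odd p) :
    p ∣ (bernoulli (p - 1)).den := by
  have : Fact p.Prime := ⟨hp⟩
  obtain ⟨k, hk⟩ := hodd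
  have hk0 : 0 < k := by have := hp.two_le; omega
  obtain ⟨z, hz⟩ := Bernoulli.vonStaudt_clausen k
  rw [show p - 1 = 2 * k by omega]
  by_contra hden
  -- Otherwise all terms of the sum but `1 / p` would be `p`-adically integral.
  set s := (Finset.range (2 * k + 2)).filter fun q ↦ q.Prime ∧ (q - 1) ∣ 2 * k
  have hps : p ∈ s := Finset.mem_filter.mpr
    ⟨Finset.mem_range.mpr (by omega), hp, by rw [hk, Nat.add_sub_cancel]⟩
  rw [← Finset.add_sum_erase s _ hps] at hz
  have hq : ∀ q ∈ s.erase p, ‖(((1 : ℚ) / q : ℚ) : ℚ_[p])‖ ≤ 1 := by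
    intro q hq
    obtain ⟨hqp, hqs⟩ := Finset.mem_erase.mp hq
    have hq' : q.Prime := (Finset.mem_filter.mp hqs).2.1
    have : ‖(q : ℚ_[p])‖ = 1 :=
      Padic.norm_natCast_eq_one_iff.mpr ((Nat.coprime_primes hp hq').mpr hqp.symm)
    push_cast
    rw [norm_div, this]
    simp
  have hsum : ‖((∑ q ∈ s.erase p, (1 : ℚ) / q : ℚ) : ℚ_[p])‖ ≤ 1 := by
    rw [Rat.cast_sum]
    exact IsUltrametricDist.norm_sum_le_of_forall_le_of_nonneg zero_le_one hq
  have hpinv : ‖(((1 : ℚ) / p : ℚ) : ℚ_[p])‖ ≤ 1 := by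
    have : (1 : ℚ) / p = (z : ℚ) - bernoulli (2 * k) - ∑ q ∈ s.erase p, (1 : ℚ) / q := by
      rw [hz]
      ring
    rw [this, Rat.cast_sub, Rat.cast_sub]
    refine (PadicInt.subring p).sub_mem ((PadicInt.subring p).sub_mem ?_ ?_) hsum
    · exact_mod_cast Padic.norm_int_le_one (p := p) z
    · exact Padic.norm_rat_le_one hden
  push_cast at hpinv
  rw [norm_div, Padic.norm_p, norm_one, one_div, inv_inv] at hpinv
  exact absurd hp.one_lt (not_lt.mpr (by exact_mod_cast hpinv))

/-- There is a level one form of weight `w` with integral `q`-expansion that is congruent to a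
constant `c` prime to `p`, modulo `p`. -/
def HasFormCongruentToUnit (p : ℕ) (w : ℤ) : Prop :=
  ∃ (c : ℤ) (F : ℤ⟦X⟧), ¬ (p : ℤ) ∣ c ∧
    IsQExpansionOfWeight w (PowerSeries.map (Int.castRingHom ℂ) (PowerSeries.C c + p * F))

namespace HasFormCongruentToUnit

variable {p : ℕ} {w v : ℤ}

lemma one (hp : p.Prime) : HasFormCongruentToUnit p 0 :=
  ⟨1, 0, fun h ↦ hp.not_dvd_one (by exact_mod_cast h), 1, by simpa using! qExpansion_one 1⟩

lemma mul (hp : p.Prime) (hw : HasFormCongruentToUnit p w) (hv : HasFormCongruentToUnit p v) :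
    HasFormCongruentToUnit p (w + v) := by
  obtain ⟨c, F, hc, hF⟩ := hw
  obtain ⟨d, G, hd, hG⟩ := hv
  refine ⟨c * d, PowerSeries.C c * G + F * PowerSeries.C d + p * F * G,
    (Nat.prime_iff_prime_int.mp hp).not_dvd_mul hc hd, ?_⟩
  convert hF.mul hG using 1
  rw [← map_mul]
  congr 1
  rw [map_mul]
  ring

lemma pow (hp : p.Prime) (hw : HasFormCongruentToUnit p w) (n : ℕ) :
    HasFormCongruentToUnit p (n * w) := by
  induction n with
  | zero => simpa using one hp
  | succ n ih => simpa [add_mul] using ih.mul hp hw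

/-- Modulo `2` and `3` both `E₄` and `E₆` are congruent to `1`, so that every even
weight from `4` on is reached. -/
lemma of_eq_two_or_eq_three (hp : p = 2 ∨ p = 3) (hw : 4 ≤ w) (hw2 : Even w) :
    HasFormCongruentToUnit p w := by
  have hpp : p.Prime := by
    rcases hp with rfl | rfl
    exacts [Nat.prime_two, Nat.prime_three]
  have hp1 : ¬ (p : ℤ) ∣ 1 := fun h ↦ hpp.not_dvd_one (by exact_mod_cast h)
  have h4 : HasFormCongruentToUnit p 4 := by
    refine ⟨1, (240 / p : ℕ) * sigmaSeries 3, hp1, ModularForm.E₄, ?_⟩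
    rw [← map_E₄, ← mul_assoc, ← Nat.cast_mul,
      Nat.mul_div_cancel' (by rcases hp with rfl | rfl <;> norm_num)]
    simp
  have h6 : HasFormCongruentToUnit p 6 := by
    refine ⟨1, -((504 / p : ℕ) * sigmaSeries 5), hp1, ModularForm.E₆, ?_⟩
    rw [← map_E₆, mul_neg, ← mul_assoc, ← Nat.cast_mul,
      Nat.mul_div_cancel' (by rcases hp with rfl | rfl <;> norm_num)]
    simp [sub_eq_add_neg]
  obtain ⟨a, b, rfl⟩ : ∃ a b : ℕ, w = a * 4 + b * 6 := by
    obtain ⟨n, rfl⟩ := hw2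
    rcases Int.even_or_odd' n with ⟨m, rfl | rfl⟩
    · exact ⟨m.toNat, 0, by omega⟩
    · exact ⟨(m - 1).toNat, 1, by omega⟩
  exact (h4.pow hpp a).mul hpp (h6.pow hpp b)

/-- For `p ≥ 5` the numerator of `B_{p-1}` times `E_{p-1}` will do: by the theorem of von Staudt
and Clausen `p` divides the denominator of `B_{p-1}`. -/
lemma of_five_le (hp : p.Prime) (h5 : 5 ≤ p) : HasFormCongruentToUnit p ((p : ℤ) - 1) := by
  have hodd : Odd p := hp.odd_of_ne_two (by omega)
  have hev : Even (p - 1) := hp.even_sub_one (by omega)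
  set B := bernoulli (p - 1)
  have hden : p ∣ B.den := dvd_den_bernoulli hp hodd
  have hnum : ¬ (p : ℤ) ∣ B.num := fun h ↦ hp.one_lt.ne'
    (Nat.eq_one_of_dvd_coprimes B.reduced (Int.natCast_dvd.mp h) hden)
  obtain ⟨d, hd⟩ := hden
  have hB0 : B ≠ 0 := fun h ↦ hnum (by simp [h])
  have hmap := map_one_add_sigmaSeries (k := p - 1) (by omega) hev B.num
    (-(2 * (p - 1 : ℕ) * (p * d))) (by
      have hC : (B : ℂ) * (p * d) = B.num := by
        have : B * (p * d) = B.num := by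
          rw [← Nat.cast_mul, ← hd]
          exact Rat.mul_den_eq_num B
        exact_mod_cast congrArg (Rat.cast : ℚ → ℂ) this
      have hB0' : (B : ℂ) ≠ 0 := Rat.cast_ne_zero.mpr hB0
      change (B.num : ℂ) * -(2 * (p - 1 : ℕ) / (B : ℂ)) = _
      rw [← hC]
      push_cast
      field_simp)
  refine ⟨B.num, PowerSeries.C (-(2 * (p - 1 : ℕ) * d : ℤ)) * sigmaSeries (p - 1 - 1), hnum, ?_⟩
  have hw : ((p - 1 : ℕ) : ℤ) = (p : ℤ) - 1 := by have := hp.one_lt; omega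
  rw [← hw]
  convert IsQExpansionOfWeight.smul (k := ((p - 1 : ℕ) : ℤ)) ⟨ModularForm.E (by omega), rfl⟩
    (B.num : ℂ) using 1
  rw [← hmap]
  congr 2
  rw [← mul_assoc]
  congr 1
  rw [show (p : ℤ⟦X⟧) = PowerSeries.C (p : ℤ) by simp, ← map_mul]
  congr 1
  ring

end HasFormCongruentToUnit

/-! ### Weakly holomorphic forms and the congruence -/

/-- The part of a Laurent series in degrees `≥ -P`, as a power series after multiplication by
`q ^ P`. -/
noncomputable def LaurentSeries.shift {R : Type*} [Zero R] (a : LaurentSeries R) (P : ℕ) : R⟦X⟧ :=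
  PowerSeries.mk fun n ↦ a.coeff (n - P)

lemma HasFourierExpansion.hasQSeries_shift {f : ℍ → ℂ} {R : Type*} [CommRing R] (σ : R →+* ℂ)
    {a : LaurentSeries R} (h : HasFourierExpansion f (HahnSeries.map a σ)) {P : ℕ}
    (ha : ∀ n : ℤ, n < -P → a.coeff n = 0) :
    HasQSeries (fun τ ↦ f τ * Function.Periodic.qParam 1 (τ : ℂ) ^ P)
      (PowerSeries.map σ (a.shift P)) := by
  intro τ
  set q := Function.Periodic.qParam 1 (τ : ℂ)
  have hq : q ≠ 0 := Function.Periodic.qParam_ne_zero _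
  have h1 := (Equiv.subRight (P : ℤ)).hasSum_iff.mpr ((h τ).mul_right (q ^ P))
  have h2 := (Nat.cast_injective (R := ℤ)).hasSum_iff (f := _) (a := f τ * q ^ P)
    (fun n hn ↦ ?_) |>.mpr h1
  · refine h2.congr_fun fun n ↦ ?_
    simp only [Function.comp_apply, Equiv.subRight_apply, HahnSeries.map_coeff,
      PowerSeries.coeff_map, LaurentSeries.shift, PowerSeries.coeff_mk]
    rw [mul_assoc, ← zpow_natCast q P, ← zpow_add₀ hq, sub_add_cancel, zpow_natCast]
  · have hn0 : n < 0 := by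
      by_contra hn0
      exact hn ⟨n.toNat, by omega⟩
    simp [ha (n - P) (by omega)]

/-- Multiplying by `Δ ^ P`, which has a zero of order `P` at infinity, turns a weakly holomorphic
form with a pole of order at most `P` into a modular form. -/
lemma WeaklyHolomorphicModularForm.isQExpansionOfWeight {k : ℤ}
    (f : WeaklyHolomorphicModularForm k) {P : ℕ} {A U : ℂ⟦X⟧}
    (hf : HasQSeries (fun τ ↦ f τ * Function.Periodic.qParam 1 (τ : ℂ) ^ P) A)
    (hU : qExpansion 1 ModularForm.discriminant = PowerSeries.X * U) :
    IsQExpansionOfWeight (k + P * 12) (A * U ^ P) := by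
  have hΔ : HasQSeries ModularForm.discriminant (PowerSeries.X * U) :=
    hU ▸ ModularFormClass.hasQSeries CuspForm.discriminant
  have h := hf.mul (hΔ.div_qParam.pow P)
  have hfun : (fun τ : ℍ ↦ f τ * Function.Periodic.qParam 1 (τ : ℂ) ^ P) *
      (fun τ : ℍ ↦ ModularForm.discriminant τ / Function.Periodic.qParam 1 (τ : ℂ)) ^ P =
      (f : ℍ → ℂ) * ModularForm.discriminant ^ P := by
    ext τ
    have hq : Function.Periodic.qParam 1 (τ : ℂ) ≠ 0 := Function.Periodic.qParam_ne_zero _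
    simp only [Pi.mul_apply, Pi.pow_apply]
    rw [mul_assoc, ← mul_pow, mul_div_cancel₀ _ hq]
  rw [hfun] at h
  let D : ModularForm 𝒮ℒ (P * 12) := (CuspForm.discriminant : ModularForm 𝒮ℒ 12).pow P
  have hD : (D : ℍ → ℂ) = ModularForm.discriminant ^ P := ModularForm.coe_pow _ _
  rw [← hD] at h
  refine h.isQExpansionOfWeight (f.holo'.mul D.holo') fun γ ↦ ?_
  rw [ModularForm.mul_slash_SL2]
  congr 1
  · exact f.slash_action_eq' _ ⟨γ, rfl⟩
  · exact D.slash_action_eq' _ ⟨γ, rfl⟩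

/-- Pairing `f` with `g = F * (q dj/dq) ^ (p ^ t)`, where `F` of weight `w` is congruent to a unit
modulo `p`: the product has weight two and hence no constant term. Modulo `p` the form `g` is a unit
times `q ^ (-p ^ t)` up to terms of degree at least `p ^ t`, and those only meet coefficients of `f`
in degrees at most `-p ^ t`, which vanish. -/
theorem dvd_coeff_of_hasFormCongruentToUnit {R : Type*} [CommRing R] (σ : R →+* ℂ)
    (hσ : Function.Injective σ) {k w : ℤ} (f : WeaklyHolomorphicModularForm k)
    {a : LaurentSeries R} (hfa : HasFourierExpansion f (HahnSeries.map a σ)) {p t : ℕ}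
    (hp : p.Prime) (hord : ∀ n : ℤ, n ≤ -(p : ℤ) ^ t → a.coeff n = 0)
    (hF : HasFormCongruentToUnit p w) (hw : k + 2 * (p : ℤ) ^ t + w = 2) :
    (p : R) ∣ a.coeff ((p : ℤ) ^ t) := by
  obtain ⟨c, F, hc, hFw⟩ := hF
  obtain ⟨U, Y, T, hU, hUY, hE⟩ := exists_integral_unit_discriminant
  obtain ⟨P, hP⟩ : ∃ P, P = p ^ t := ⟨_, rfl⟩
  set A := a.shift P
  have hPz : (p : ℤ) ^ t = P := by simp [hP]
  rw [hPz] at hord hw ⊢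
  have hA := f.isQExpansionOfWeight
    (hfa.hasQSeries_shift σ (fun n hn ↦ hord n hn.le) : HasQSeries _ (PowerSeries.map σ A)) hU
  have hUY' : PowerSeries.map (Int.castRingHom ℂ) U * PowerSeries.map (Int.castRingHom ℂ) Y =
      1 := by
    rw [← map_mul, hUY, map_one]
  have hG := ((hA.mul hFw).mul
    (((isQExpansionOfWeight_E₄.pow 2).mul isQExpansionOfWeight_E₆).pow P)).congr_weight
      (l := 12 * (2 * P : ℕ) + 2) (by push_cast; linarith)
  have hres := coeff_mul_pow_eq_zero_of_weight hU hUY' (2 * P) hG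
  set ι := Int.castRingHom R
  have hι (B : ℤ⟦X⟧) : PowerSeries.map (Int.castRingHom ℂ) B =
      PowerSeries.map σ (PowerSeries.map ι B) := by
    ext n
    simp [ι]
  -- The vanishing residue, as an identity over `R`.
  have hR : (A * PowerSeries.map ι ((PowerSeries.C c + (p : ℤ⟦X⟧) * F) *
      (1 + PowerSeries.X ^ 2 * T) ^ P)).coeff (2 * P) = 0 := by
    apply hσ
    rw [map_zero, ← PowerSeries.coeff_map, ← hres]
    congr 1
    rw [map_mul, ← hι, map_mul, map_pow, ← hE]
    set u := PowerSeries.map (Int.castRingHom ℂ) U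
    set y := PowerSeries.map (Int.castRingHom ℂ) Y
    have huy : u ^ P * y ^ P = 1 := by rw [← mul_pow, hUY', one_pow]
    rw [mul_pow, two_mul, pow_add]
    linear_combination (-(PowerSeries.map σ A *
      PowerSeries.map (Int.castRingHom ℂ) (PowerSeries.C c + (p : ℤ⟦X⟧) * F) *
      (qExpansion 1 ModularForm.E₄ ^ 2 * qExpansion 1 ModularForm.E₆) ^ P * y ^ P)) * huy
  obtain ⟨r, hr⟩ := exists_add_pow_prime_pow_eq hp (1 : ℤ⟦X⟧) (PowerSeries.X ^ 2 * T) t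
  rw [← hP, one_pow, mul_pow, ← pow_mul] at hr
  -- Modulo `p` only the terms `1` and `X ^ (2 * P) * T ^ P` of the power survive.
  have hexp : A * PowerSeries.map ι
        ((PowerSeries.C c + (p : ℤ⟦X⟧) * F) * (1 + PowerSeries.X ^ 2 * T) ^ P) =
      PowerSeries.C (c : R) * A +
      PowerSeries.X ^ (2 * P) * (PowerSeries.C (c : R) * A * PowerSeries.map ι (T ^ P)) +
      PowerSeries.C (p : R) * (A * PowerSeries.map ι (F * (1 + PowerSeries.X ^ 2 * T) ^ P +
        PowerSeries.C c * (1 * (PowerSeries.X ^ 2 * T) * r))) := by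
    have hz : (PowerSeries.C c + (p : ℤ⟦X⟧) * F) * (1 + PowerSeries.X ^ 2 * T) ^ P =
        PowerSeries.C c + PowerSeries.X ^ (2 * P) * (PowerSeries.C c * T ^ P) +
        (p : ℤ⟦X⟧) * (F * (1 + PowerSeries.X ^ 2 * T) ^ P +
          PowerSeries.C c * (1 * (PowerSeries.X ^ 2 * T) * r)) := by
      linear_combination PowerSeries.C c * hr
    have hC : PowerSeries.map ι (PowerSeries.C c) = PowerSeries.C (c : R) := by simp [ι]
    have hp' : PowerSeries.map ι (p : ℤ⟦X⟧) = PowerSeries.C (p : R) := by simp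
    rw [hz, map_add, map_add, map_mul, map_mul _ (p : ℤ⟦X⟧), map_mul _ (PowerSeries.C c), map_pow,
      PowerSeries.map_X, hC, hp']
    ring
  have hA0 : PowerSeries.constantCoeff A = 0 := by
    rw [← PowerSeries.coeff_zero_eq_constantCoeff_apply]
    simpa [A, LaurentSeries.shift] using hord (-P) le_rfl
  have hAP : A.coeff (2 * P) = a.coeff P := by
    simp only [A, LaurentSeries.shift, PowerSeries.coeff_mk]
    congr 1
    push_cast
    ring
  rw [hexp, map_add, map_add, PowerSeries.coeff_C_mul, PowerSeries.coeff_C_mul, hAP,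
    PowerSeries.coeff_X_pow_mul'] at hR
  simp only [le_refl, if_true, Nat.sub_self, PowerSeries.coeff_zero_eq_constantCoeff, map_mul, hA0,
    mul_zero, zero_mul, add_zero] at hR
  have hdvd : (p : R) ∣ c * a.coeff P := ⟨_, eq_neg_of_add_eq_zero_left hR |>.trans
    (mul_neg _ _).symm⟩
  have hcop : IsCoprime (p : R) (c : R) := by
    have h := ((Nat.prime_iff_prime_int.mp hp).coprime_iff_not_dvd.mpr hc).map ι
    simpa [ι] using h
  exact hcop.dvd_of_dvd_mul_left hdvd

theorem theorem1p1 {L : Type*} [Field L] [NumberField L] (σ : L →+* ℂ)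
    (k : ℤ) (hk : Even k) (f : WeaklyHolomorphicModularForm k)
    (a : LaurentSeries (𝓞 L))
    (hfa : HasFourierExpansion f (HahnSeries.map a (σ.comp (algebraMap (𝓞 L) L))))
    (p t : ℕ) (hp : p.Prime)
    (hord : ((-(p : ℤ) ^ t : ℤ) : WithTop ℤ) < ordInfty a) :
    (5 ≤ p → ∀ r : ℕ, 0 < t → 2 - k = r * ((p : ℤ) - 1) + 2 * (p : ℤ) ^ t →
      (p : 𝓞 L) ∣ a.coeff ((p : ℤ) ^ t)) ∧
    ((p = 2 ∨ p = 3) → ∀ m : ℤ, 4 ≤ m → Even m → k + 2 * (p : ℤ) ^ t + m = 2 →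
      (p : 𝓞 L) ∣ a.coeff ((p : ℤ) ^ t)) := by
  have hσ : Function.Injective (σ.comp (algebraMap (𝓞 L) L)) :=
    σ.injective.comp (FaithfulSMul.algebraMap_injective (𝓞 L) L)
  have ha (n : ℤ) (hn : n ≤ -(p : ℤ) ^ t) : a.coeff n = 0 :=
    HahnSeries.coeff_eq_zero_of_lt_orderTop ((WithTop.coe_le_coe.mpr hn).trans_lt hord)
  refine ⟨fun h5 r _ h ↦ ?_, fun h23 m hm hm2 h ↦ ?_⟩
  · exact dvd_coeff_of_hasFormCongruentToUnit _ hσ f hfa hp ha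
      ((HasFormCongruentToUnit.of_five_le hp h5).pow hp r) (by linarith)
  · exact dvd_coeff_of_hasFormCongruentToUnit _ hσ f hfa hp ha
      (HasFormCongruentToUnit.of_eq_two_or_eq_three h23 hm hm2) h
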